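/- Let $q=2^h$ with $h>1$, and let $n$ be a prime. A pseudo-hyperoval $\mathcal H$ in $\mathrm{PG}(3n-1,q)$ is a set of $q^n+2$ subspaces of projective dimension $n-1$ such that $\langle E,E'\rangle\cap E''=\emptyset$ for any three distinct $E,E',E''\in\mathcal H$. An element $E\in\mathcal H$ induces the spread $\{\langle E,E'\rangle/E : E'\in\mathcal H\setminus\{E\}\}$ of the quotient space $\mathrm{PG}(3n-1,q)/E\cong\mathrm{PG}(2n-1,q)$. Identifying $(\mathbb F_{q^n})^r$ with $\mathbb F_q^{rn}$ by an $\mathbb F_q$-linear isomorphism, every point of $\mathrm{PG}(r-1,q^n)$ becomes an $(n-1)$-dimensional subspace of $\mathrm{PG}(rn-1,q)$ (field reduction); the set of all these subspaces, for any choice of the isomorphism, is called a Desarguesian spread of $\mathrm{PG}(rn-1,q)$. The set $\mathcal H$ is called elementary if it arises by field reduction from an arc of $\mathrm{PG}(2,q^n)$, i.e. from a set of points no three of which are collinear. A Segre variety $\mathbf S_{n-1,2}$ in $\mathrm{PG}(3n-1,q)$ is, in suitable coordinates indexed by pairs $(i,j)$ with $1\le i\le n$, $1\le j\le 3$, the set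 of points $(x_iy_j)_{i,j}$ with $x\in\mathbb F_q^n\setminus\{0\}$, $y\in\mathbb F_q^3\setminus\{0\}$; it is said to contain an $(n-1)$-space $E$ if $E$ belongs to its system of $(n-1)$-spaces, i.e. if $E$ is obtained by fixing $y$ and letting $x$ vary (for $n=3$ the two systems play symmetric roles, and the system meant is the one containing the four given spaces). Four $(n-1)$-spaces, any three of which span $\mathrm{PG}(3n-1,q)$, are contained in a unique Segre variety $\mathbf S_{n-1,2}$. Suppose that a pseudo-hyperoval $\mathcal H$ in $\mathrm{PG}(3n-1,q)$ has four distinct elements $E_1,E_2,E_3,E_4$ such that (i) the spreads induced by $E_1$, $E_2$ and $E_3$ are Desarguesian, and (ii) the unique Segre variety $\mathbf S_{n-1,2}$ containing $E_1,E_2,E_3,E_4$ does not contain $q+2$ elements of $\mathcal H$. Then $\mathcal H$ is elementary. -/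

import Mathlib

/-! A projective space `PG(d - 1, q)` is given by a vector space of dimension `d` over a finite
field `F` with `q` elements; its `(n - 1)`-spaces are the linear subspaces of dimension `n`. -/

/-- A set of `(n - 1)`-spaces such that the span of any two is disjoint from any third one. -/
structure IsPseudoArc {F V : Type*} [Field F] [AddCommGroup V] [Module F V]
    (n : ℕ) (A : Set (Submodule F V)) : Prop where
  finrank_eq : ∀ E ∈ A, Module.finrank F E = n
  disjoint : ∀ E₁ ∈ A, ∀ E₂ ∈ A, ∀ E₃ ∈ A, E₁ ≠ E₂ → E₁ ≠ E₃ → E₂ ≠ E₃ →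
    Disjoint (E₁ ⊔ E₂) E₃

/-- A pseudo-arc with `q ^ n + 2` elements (to be used in a space of dimension `3 * n`). -/
structure IsPseudoHyperoval {F V : Type*} [Field F] [AddCommGroup V] [Module F V]
    (n : ℕ) (H : Set (Submodule F V)) : Prop where
  isPseudoArc : IsPseudoArc n H
  ncard_eq : H.ncard = Nat.card F ^ n + 2

/-- Field reduction: an identification `φ` of `V` with `K ^ r` turns a point of the projective
space `PG(r - 1, K)` into an `F`-subspace of `V`. -/
def fieldReduction {F K V : Type*} [Field F] [Field K] [Algebra F K] [AddCommGroup V]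
    [Module F V] {r : ℕ} (φ : V ≃ₗ[F] (Fin r → K))
    (P : Projectivization K (Fin r → K)) : Submodule F V :=
  (P.submodule.restrictScalars F).comap φ.toLinearMap

/-- A Desarguesian spread: the field reduction of all the points of `PG(r - 1, K)`. -/
def IsDesarguesianSpread {F V : Type*} [Field F] [AddCommGroup V] [Module F V]
    (K : Type*) [Field K] [Algebra F K] (r : ℕ) (D : Set (Submodule F V)) : Prop :=
  ∃ φ : V ≃ₗ[F] (Fin r → K), D = Set.range (fieldReduction φ)

/-- An arc of the projective plane `PG(2, K)`: a set of points, no three of them collinear. -/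
def IsPlaneArc {K : Type*} [Field K] (A : Set (Projectivization K (Fin 3 → K))) : Prop :=
  ∀ P ∈ A, ∀ Q ∈ A, ∀ R ∈ A, P ≠ Q → P ≠ R → Q ≠ R →
    Projectivization.Independent ![P, Q, R]

/-- A set of subspaces that arises from an arc of `PG(2, K)` by field reduction. -/
def IsElementary {F V : Type*} [Field F] [AddCommGroup V] [Module F V]
    (K : Type*) [Field K] [Algebra F K] (H : Set (Submodule F V)) : Prop :=
  ∃ (φ : V ≃ₗ[F] (Fin 3 → K)) (A : Set (Projectivization K (Fin 3 → K))),
    IsPlaneArc A ∧ H = fieldReduction φ '' A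

/-- The partial spread `{E' / E : E' ∈ H, E' ≠ E}` that `E ∈ H` induces in the quotient by `E`. -/
def inducedSpread {F V : Type*} [Field F] [AddCommGroup V] [Module F V]
    (H : Set (Submodule F V)) (E : Submodule F V) : Set (Submodule F (V ⧸ E)) :=
  (fun E' => E'.map E.mkQ) '' (H \ {E})

/-- The system of `(n - 1)`-spaces of a Segre variety `S_{n-1,2}`. In the coordinates `θ`
the points of the variety are those represented by the rank one matrices `(x i * y j)`, and the
`(n - 1)`-spaces of the system are obtained by fixing `y ≠ 0` and letting `x` vary. -/
def IsSegreSystem {F V : Type*} [Field F] [AddCommGroup V] [Module F V]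
    (n : ℕ) (B : Set (Submodule F V)) : Prop :=
  ∃ θ : V ≃ₗ[F] Matrix (Fin n) (Fin 3) F,
    B = {S | ∃ y : Fin 3 → F, y ≠ 0 ∧
      ∀ v : V, v ∈ S ↔ ∃ x : Fin n → F, θ v = Matrix.vecMulVec x y}

/-- Property (P1): there are four distinct elements of `H`, the first three of which induce
Desarguesian spreads, such that the Segre variety `S_{n-1,2}` through the four (for a pseudo-arc
in a space of dimension `3 * n` it exists and is unique) does not contain `q + 2` elements
of `H`. -/
def PropertyP1 {F V : Type*} [Field F] [AddCommGroup V] [Module F V]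
    (K : Type*) [Field K] [Algebra F K] (n : ℕ) (H : Set (Submodule F V)) : Prop :=
  ∃ E : Fin 4 → Submodule F V, Function.Injective E ∧ (∀ i, E i ∈ H) ∧
    IsDesarguesianSpread K 2 (inducedSpread H (E 0)) ∧
    IsDesarguesianSpread K 2 (inducedSpread H (E 1)) ∧
    IsDesarguesianSpread K 2 (inducedSpread H (E 2)) ∧
    ∃ B : Set (Submodule F V), IsSegreSystem n B ∧ (∀ i, E i ∈ B) ∧
      ¬ Nat.card F + 2 ≤ (H ∩ B).ncard

/-! Take coordinates `W ^ 3`, `W = F ^ n`, in which `E 0`, `E 1`, `E 2` are the axes and `E 3` is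
the diagonal; the Segre variety then contains every space `{(y₀ w, y₁ w, y₂ w)}` with `y ≠ 0` over
`F` (`IsSegreSystem.exists_frame`). An element of `H` other than an axis is a graph `{(w, A w, C
w)}` with `C = G A`. The Desarguesian spreads at the three axes put `G`, `C`, `A` into fields `K₀`,
`K₁`, `K₂` of endomorphisms, each a copy of `K` (`IsPseudoArc.exists_slopes`).

As `K` has prime degree over `F`, the algebra `K₀ ∩ K₂` is either `F` or all of `K₂`. In the second
case `A` and `C = G A` always lie in `K₀`, so `H` is part of one Desarguesian spread and is
elementary (`IsPseudoArc.isElementary`). In the first case, each nonzero scalar `c` occurs as some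
`C`, since the spread at `E 1` realises all slopes; then `A = G⁻¹ c` lies in `K₀ ∩ K₂ = F`, so that
element is on the Segre variety. These `q - 1` elements and the three axes are `q + 2` in number,
which is excluded. -/

section

/-! ### Field reduction and the slopes of a Desarguesian spread -/

variable {F K U W V : Type*} [Field F] [Field K] [Algebra F K] [AddCommGroup U] [Module F U]
  [AddCommGroup W] [Module F W] [AddCommGroup V] [Module F V]

/-- The action of `K` on `W` by multiplication, transported along `α : W ≃ K`. -/
def conjMul (α : W ≃ₗ[F] K) : K →ₐ[F] Module.End F W :=
  (α.symm.conjAlgEquiv F).toAlgHom.comp (Algebra.lmul F K)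

@[simp]
theorem apply_conjMul (α : W ≃ₗ[F] K) (k : K) (w : W) : α (conjMul α k w) = k * α w := by
  simp [conjMul]

theorem mem_fieldReduction_mk {r : ℕ} (φ : V ≃ₗ[F] (Fin r → K)) (v : Fin r → K) (hv : v ≠ 0)
    (u : V) : u ∈ fieldReduction φ (Projectivization.mk K v hv) ↔ ∃ k : K, φ u = k • v := by
  simp [fieldReduction, Projectivization.submodule_mk, Submodule.mem_span_singleton, eq_comm]

theorem mem_range_fieldReduction {r : ℕ} (φ : V ≃ₗ[F] (Fin r → K)) (S : Submodule F V) :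
    S ∈ Set.range (fieldReduction φ) ↔
      ∃ v : Fin r → K, v ≠ 0 ∧ ∀ u, u ∈ S ↔ ∃ k : K, φ u = k • v := by
  constructor
  · rintro ⟨P, rfl⟩
    induction P with
    | h v hv => exact ⟨v, hv, mem_fieldReduction_mk φ v hv⟩
  · rintro ⟨v, hv, h⟩
    refine ⟨Projectivization.mk K v hv, ?_⟩
    ext u
    rw [mem_fieldReduction_mk, h]

/-- A spread element is a `K`-line, so any of its nonzero vectors can serve as generator. -/
theorem mem_iff_of_mem_range_fieldReduction {r : ℕ} {φ : V ≃ₗ[F] (Fin r → K)}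
    {S : Submodule F V} (hS : S ∈ Set.range (fieldReduction φ)) {u₀ : V} (hu₀ : u₀ ∈ S)
    (hne : u₀ ≠ 0) (u : V) : u ∈ S ↔ ∃ k : K, φ u = k • φ u₀ := by
  obtain ⟨v, -, h⟩ := (mem_range_fieldReduction φ S).1 hS
  obtain ⟨c, hc⟩ := (h u₀).1 hu₀
  have hc0 : c ≠ 0 := by
    rintro rfl
    exact hne (φ.map_eq_zero_iff.1 (by simpa using hc))
  rw [h]
  constructor
  · rintro ⟨k, hk⟩
    exact ⟨k * c⁻¹, by rw [hk, hc, smul_smul, inv_mul_cancel_right₀ hc0]⟩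
  · rintro ⟨k, hk⟩
    exact ⟨k * c, by rw [hk, hc, smul_smul]⟩

/-- If two elements of a Desarguesian spread are taken as axes and a third one as the unit line,
then the slopes of the spread form a field. -/
theorem IsDesarguesianSpread.exists_slopes {D : Set (Submodule F U)}
    (hD : IsDesarguesianSpread K 2 D) [Nontrivial W] (ja jb : W →ₗ[F] U)
    (hinj : ∀ x y, ja x + jb y = 0 → x = 0 ∧ y = 0)
    (ha : LinearMap.range ja ∈ D) (hb : LinearMap.range jb ∈ D)
    (hab : LinearMap.range (ja + jb) ∈ D) :
    ∃ α : W ≃ₗ[F] K, ∀ S, S ∈ D ↔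
      S = LinearMap.range jb ∨ ∃ k, S = LinearMap.range (ja + jb ∘ₗ conjMul α k) := by
  obtain ⟨φ, rfl⟩ := hD
  obtain ⟨w₀, hw₀⟩ := exists_ne (0 : W)
  have hpa := mem_iff_of_mem_range_fieldReduction ha ⟨w₀, rfl⟩
    (fun h => hw₀ (hinj w₀ 0 (by simp [h])).1)
  have hqb := mem_iff_of_mem_range_fieldReduction hb ⟨w₀, rfl⟩
    (fun h => hw₀ (hinj 0 w₀ (by simp [h])).2)
  have hrab := mem_iff_of_mem_range_fieldReduction hab ⟨w₀, rfl⟩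
    (fun h => hw₀ (hinj w₀ w₀ h).1)
  set p := φ (ja w₀) with hp
  set q := φ (jb w₀) with hq
  have hpq : LinearIndependent K ![p, q] := by
    have hp0 : p ≠ 0 := fun h => hw₀ (hinj w₀ 0 (by simp [φ.map_eq_zero_iff.1 h])).1
    rw [LinearIndependent.pair_iff' hp0]
    intro t ht
    obtain ⟨y, hy⟩ := (hpa (jb w₀)).2 ⟨t, ht.symm⟩
    exact hw₀ (hinj (-y) w₀ (by simp [hy])).2
  -- In the `K`-basis `p, q` the two axes become the coordinate axes of `K ^ 2`.
  let B := basisOfLinearIndependentOfCardEqFinrank hpq (by simp)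
  have hB0 : B.equivFun p = ![1, 0] := by
    have : B 0 = p := by simp [B]
    ext i; fin_cases i <;> simp [← this]
  have hB1 : B.equivFun q = ![0, 1] := by
    have : B 1 = q := by simp [B]
    ext i; fin_cases i <;> simp [← this]
  let ψ : U ≃ₗ[F] (Fin 2 → K) := φ ≪≫ₗ (B.equivFun.restrictScalars F)
  have hψ (u : U) : ψ u = B.equivFun (φ u) := rfl
  have hψa (w : W) : ψ (ja w) 1 = 0 := by
    obtain ⟨k, hk⟩ := (hpa (ja w)).1 ⟨w, rfl⟩
    simp [hψ, hk, hB0, -Module.Basis.equivFun_apply]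
  have hψb (w : W) : ψ (jb w) 0 = 0 := by
    obtain ⟨k, hk⟩ := (hqb (jb w)).1 ⟨w, rfl⟩
    simp [hψ, hk, hB1, -Module.Basis.equivFun_apply]
  have hψr : φ ((ja + jb) w₀) = p + q := by simp [hp, hq]
  -- The unit line is the `K`-line of `p + q`, so both axes are coordinatised by the same map, which
  -- will be `α`.
  have hψab (w : W) : ψ (jb w) 1 = ψ (ja w) 0 := by
    obtain ⟨k, hk⟩ := (hrab ((ja + jb) w)).1 ⟨w, rfl⟩
    have h : ψ ((ja + jb) w) = k • (![1, 0] + ![0, 1]) := by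
      rw [hψ, hk, hψr, map_smul, map_add, hB0, hB1]
    have h0 := congrFun h 0
    have h1 := congrFun h 1
    simp [hψa, hψb] at h0 h1
    rw [h0, h1]
  let α₀ : W →ₗ[F] K := LinearMap.proj 0 ∘ₗ ψ.toLinearMap ∘ₗ ja
  have hα₀ (w : W) : α₀ w = ψ (ja w) 0 := rfl
  have hα : Function.Bijective α₀ := by
    constructor
    · rw [injective_iff_map_eq_zero]
      intro w hw
      have : ψ (ja w) = 0 := by
        ext i; fin_cases i
        · exact hw
        · exact hψa w
      exact (hinj w 0 (by simpa using this)).1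
    · intro k
      obtain ⟨w, hw⟩ := (hpa (ψ.symm ![k, 0])).2 ⟨k, by
        apply B.equivFun.injective
        rw [← hψ, map_smul, hB0, LinearEquiv.apply_symm_apply]
        ext i; fin_cases i <;> simp⟩
      exact ⟨w, by simp [hα₀, hw]⟩
  let α : W ≃ₗ[F] K := LinearEquiv.ofBijective α₀ hα
  have hja (w : W) : ψ (ja w) = ![α w, 0] := by
    ext i; fin_cases i
    · rfl
    · exact hψa w
  have hjb (w : W) : ψ (jb w) = ![0, α w] := by
    ext i; fin_cases i
    · exact hψb w
    · exact hψab w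
  refine ⟨α, fun S => ⟨fun hS => ?_, ?_⟩⟩
  · obtain ⟨v, hv, h⟩ := (mem_range_fieldReduction φ S).1 hS
    replace h (u : U) : u ∈ S ↔ ∃ k : K, ψ u = k • B.equivFun v := by
      rw [h]
      refine exists_congr fun k => ?_
      rw [hψ, ← map_smul, B.equivFun.injective.eq_iff]
    have hv' : B.equivFun v ≠ 0 := by simpa [-Module.Basis.equivFun_apply] using hv
    generalize B.equivFun v = v at h hv'
    by_cases hv0 : v 0 = 0
    · left
      have hv1 : v 1 ≠ 0 := fun hv1 => hv' (by ext i; fin_cases i <;> assumption)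
      ext u
      rw [h]
      constructor
      · rintro ⟨k, hk⟩
        refine ⟨α.symm (k * v 1), ψ.injective ?_⟩
        rw [hk, hjb]
        ext i; fin_cases i <;> simp [hv0]
      · rintro ⟨w, rfl⟩
        refine ⟨α w * (v 1)⁻¹, ?_⟩
        rw [hjb]
        ext i; fin_cases i <;> simp [hv0, hv1]
    · right
      refine ⟨v 1 / v 0, ?_⟩
      ext u
      rw [h]
      constructor
      · rintro ⟨k, hk⟩
        refine ⟨α.symm (k * v 0), ψ.injective ?_⟩
        rw [hk, LinearMap.add_apply, map_add, LinearMap.comp_apply, hja, hjb]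
        ext i; fin_cases i <;> simp
        field_simp
      · rintro ⟨w, rfl⟩
        refine ⟨α w * (v 0)⁻¹, ?_⟩
        rw [LinearMap.add_apply, map_add, LinearMap.comp_apply, hja, hjb]
        ext i; fin_cases i <;> simp [hv0]
        field_simp
  · rintro (rfl | ⟨k, rfl⟩)
    · exact hb
    · rw [mem_range_fieldReduction]
      refine ⟨B.equivFun.symm ![1, k], ?_, fun u => ?_⟩
      · rw [Ne, LinearEquiv.map_eq_zero_iff]
        exact fun h => one_ne_zero (congrFun h 0)
      · have (l : K) : φ u = l • B.equivFun.symm ![1, k] ↔ ψ u = ![l, l * k] := by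
          rw [hψ, ← map_smul, LinearEquiv.eq_symm_apply]
          simp [-Module.Basis.equivFun_apply]
        simp only [this]
        constructor
        · rintro ⟨w, rfl⟩
          refine ⟨α w, ?_⟩
          rw [LinearMap.add_apply, map_add, LinearMap.comp_apply, hja, hjb]
          ext i; fin_cases i <;> simp [mul_comm]
        · rintro ⟨l, hl⟩
          refine ⟨α.symm l, ψ.injective ?_⟩
          rw [LinearMap.add_apply, map_add, LinearMap.comp_apply, hja, hjb, hl]
          ext i; fin_cases i <;> simp [mul_comm]

end

/-! ### Pseudo-arcs in a Desarguesian spread, and frames of a Segre variety -/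

section

variable {F K W V : Type*} [Field F] [Field K] [Algebra F K]
  [AddCommGroup W] [Module F W] [AddCommGroup V] [Module F V]

/-- Tailored to pseudo-arcs: a relation of this form would place one space in the span of two
others, against `IsPseudoArc.not_le_sup`. -/
theorem linearIndependent_fin_three_of_ne {M : Type*} [AddCommGroup M] [Module K M] {v : Fin 3 → M}
    (h : ∀ i j k : Fin 3, i ≠ j → i ≠ k → j ≠ k → ∀ a b : K, v i ≠ a • v j + b • v k) :
    LinearIndependent K v := by
  rw [Fintype.linearIndependent_iff]
  intro g hg
  have key (i j k : Fin 3) (hij : i ≠ j) (hik : i ≠ k) (hjk : j ≠ k)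
      (hs : g i • v i + g j • v j + g k • v k = 0) : g i = 0 := by
    by_contra hi
    refine h i j k hij hik hjk (-((g i)⁻¹ * g j)) (-((g i)⁻¹ * g k)) ?_
    have := congrArg ((g i)⁻¹ • ·) hs
    simp only [smul_add, smul_smul, inv_mul_cancel₀ hi, one_smul, smul_zero] at this
    rw [neg_smul, neg_smul, ← sub_eq_zero, ← this]
    abel
  rw [Fin.sum_univ_three] at hg
  intro i
  fin_cases i
  · exact key 0 1 2 (by decide) (by decide) (by decide) hg
  · exact key 1 0 2 (by decide) (by decide) (by decide) (by rw [← hg]; abel)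
  · exact key 2 0 1 (by decide) (by decide) (by decide) (by rw [← hg]; abel)

theorem IsPseudoArc.not_le_sup {n : ℕ} (hn : n ≠ 0) {H : Set (Submodule F V)}
    (hH : IsPseudoArc n H) {E₁ E₂ E₃ : Submodule F V} (h₁ : E₁ ∈ H) (h₂ : E₂ ∈ H) (h₃ : E₃ ∈ H)
    (h₁₂ : E₁ ≠ E₂) (h₁₃ : E₁ ≠ E₃) (h₂₃ : E₂ ≠ E₃) : ¬ E₃ ≤ E₁ ⊔ E₂ := by
  intro hle
  have hbot := (hH.disjoint E₁ h₁ E₂ h₂ E₃ h₃ h₁₂ h₁₃ h₂₃).eq_bot_of_ge hle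
  have := hH.finrank_eq E₃ h₃
  rw [hbot, finrank_bot] at this
  exact hn this.symm

/-- A pseudo-arc contained in a Desarguesian spread is elementary. -/
theorem IsPseudoArc.isElementary {n : ℕ} (hn : n ≠ 0) {H : Set (Submodule F V)}
    (hH : IsPseudoArc n H) (φ : V ≃ₗ[F] (Fin 3 → K)) (hφ : H ⊆ Set.range (fieldReduction φ)) :
    IsElementary K H := by
  refine ⟨φ, fieldReduction φ ⁻¹' H, ?_, (Set.image_preimage_eq_of_subset hφ).symm⟩
  have hinj : Function.Injective (fieldReduction φ) := by
    intro P Q hPQ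
    apply Projectivization.submodule_injective
    ext v
    have := SetLike.ext_iff.1 hPQ (φ.symm v)
    simpa [fieldReduction] using this
  intro P hP Q hQ R hR hPQ hPR hQR
  rw [Projectivization.independent_iff]
  have key (X : Fin 3 → Projectivization K (Fin 3 → K)) (hX : Function.Injective X)
      (hXH : ∀ i, fieldReduction φ (X i) ∈ H) :
      LinearIndependent K (Projectivization.rep ∘ X) := by
    have hmem (i : Fin 3) (u : V) :
        u ∈ fieldReduction φ (X i) ↔ ∃ k : K, φ u = k • (X i).rep := by
      conv_lhs => rw [← (X i).mk_rep]
      exact mem_fieldReduction_mk φ _ (X i).rep_nonzero u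
    apply linearIndependent_fin_three_of_ne
    intro i j k hij hik hjk a b h
    refine hH.not_le_sup hn (hXH j) (hXH k) (hXH i) (hinj.ne (hX.ne hjk))
      (hinj.ne (hX.ne hij.symm)) (hinj.ne (hX.ne hik.symm)) ?_
    intro u hu
    obtain ⟨c, hc⟩ := (hmem i u).1 hu
    rw [Submodule.mem_sup]
    refine ⟨φ.symm ((c * a) • (X j).rep), (hmem j _).2 ⟨c * a, by simp⟩,
      φ.symm ((c * b) • (X k).rep), (hmem k _).2 ⟨c * b, by simp⟩, φ.injective ?_⟩
    simp only [Function.comp_apply] at h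
    rw [map_add, LinearEquiv.apply_symm_apply, LinearEquiv.apply_symm_apply, hc, h, smul_add,
      smul_smul, smul_smul]
  apply key
  · intro i j hij
    fin_cases i <;> fin_cases j <;> simp_all
  · intro i
    fin_cases i <;> assumption

/-- Coordinates of `V` in which a Segre variety through four elements of a pseudo-arc is in
standard position and the four elements form the standard frame. -/
theorem IsSegreSystem.exists_frame {n : ℕ} (hn : n ≠ 0) {H B : Set (Submodule F V)}
    (hH : IsPseudoArc n H) (hB : IsSegreSystem n B) {E : Fin 4 → Submodule F V}
    (hE : Function.Injective E) (hEH : ∀ i, E i ∈ H) (hEB : ∀ i, E i ∈ B) :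
    ∃ J : (Fin 3 → Fin n → F) ≃ₗ[F] V,
      (∀ i : Fin 3, E i.castSucc = LinearMap.range (J.toLinearMap ∘ₗ LinearMap.single F _ i)) ∧
      E 3 = LinearMap.range (J.toLinearMap ∘ₗ LinearMap.pi fun _ => LinearMap.id) ∧
      ∀ y : Fin 3 → F, y ≠ 0 →
        LinearMap.range (J.toLinearMap ∘ₗ LinearMap.pi fun i => y i • LinearMap.id) ∈ B := by
  obtain ⟨θ, rfl⟩ := hB
  choose y hy0 hy using hEB
  have hdep (i j k : Fin 4) (hij : i ≠ j) (hik : i ≠ k) (hjk : j ≠ k) (a b : F) :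
      y i ≠ a • y j + b • y k := by
    intro h
    refine hH.not_le_sup hn (hEH j) (hEH k) (hEH i) (hE.ne hjk)
      (hE.ne hij.symm) (hE.ne hik.symm) ?_
    intro u hu
    obtain ⟨x, hx⟩ := (hy i u).1 hu
    rw [Submodule.mem_sup]
    refine ⟨θ.symm (Matrix.vecMulVec (a • x) (y j)), (hy j _).2 ⟨a • x, by simp⟩,
      θ.symm (Matrix.vecMulVec (b • x) (y k)), (hy k _).2 ⟨b • x, by simp⟩, θ.injective ?_⟩
    rw [map_add, LinearEquiv.apply_symm_apply, LinearEquiv.apply_symm_apply, hx, h,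
      Matrix.vecMulVec_add, Matrix.vecMulVec_smul, Matrix.vecMulVec_smul, Matrix.smul_vecMulVec,
      Matrix.smul_vecMulVec]
  have hli : LinearIndependent F fun i : Fin 3 => y i.castSucc := by
    apply linearIndependent_fin_three_of_ne
    intro i j k hij hik hjk
    exact hdep _ _ _ (Fin.castSucc_injective 3 |>.ne hij) (Fin.castSucc_injective 3 |>.ne hik)
      (Fin.castSucc_injective 3 |>.ne hjk)
  let b₀ := basisOfLinearIndependentOfCardEqFinrank hli (by simp)
  have hb₀ (i : Fin 3) : b₀ i = y i.castSucc := by simp [b₀]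
  have hsum := b₀.sum_equivFun (y 3)
  set c : Fin 3 → F := b₀.equivFun (y 3)
  simp only [hb₀, Fin.sum_univ_three] at hsum
  have hc (i : Fin 3) : c i ≠ 0 := by
    intro hi
    fin_cases i
    · exact hdep 3 1 2 (by decide) (by decide) (by decide) (c 1) (c 2) (by
        simp at hi; rw [← hsum, hi, zero_smul, zero_add]; rfl)
    · exact hdep 3 0 2 (by decide) (by decide) (by decide) (c 0) (c 2) (by
        simp at hi; rw [← hsum, hi, zero_smul, add_zero]; rfl)
    · exact hdep 3 0 1 (by decide) (by decide) (by decide) (c 0) (c 1) (by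
        simp at hi; rw [← hsum, hi, zero_smul, add_zero]; rfl)
  -- Rescaling by the coordinates of `y 3` turns `y 3` into `(1, 1, 1)`, so that `E 3` becomes the
  -- diagonal.
  let b := b₀.unitsSMul fun i => Units.mk0 (c i) (hc i)
  have hb (i : Fin 3) : b i = c i • y i.castSucc := by
    simp [b, Module.Basis.unitsSMul_apply, hb₀, Units.smul_def]
  -- Row `a` of the matrix is the vector whose `b`-coordinates are `f i a`.
  let R : (Fin 3 → Fin n → F) ≃ₗ[F] Matrix (Fin n) (Fin 3) F :=
    { toFun := fun f => Matrix.of fun a => b.equivFun.symm fun i => f i a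
      invFun := fun m i a => b.equivFun (m a) i
      map_add' := fun f g => by
        refine funext fun a => ?_
        exact b.equivFun.symm.map_add (fun i => f i a) (fun i => g i a)
      map_smul' := fun t f => by
        refine funext fun a => ?_
        exact b.equivFun.symm.map_smul t (fun i => f i a)
      left_inv := fun f => by
        ext i a
        exact congrFun (b.equivFun.apply_symm_apply fun i => f i a) i
      right_inv := fun m => by
        refine funext fun a => ?_
        exact b.equivFun.symm_apply_apply (m a) }
  have hR (y' : Fin 3 → F) (w : Fin n → F) :
      R (fun i => y' i • w) = Matrix.vecMulVec w (b.equivFun.symm y') := by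
    refine funext fun a => ?_
    have : (fun i => (y' i • w) a) = w a • y' := by
      ext i; simp [mul_comm]
    change b.equivFun.symm (fun i => (y' i • w) a) = _
    rw [this, map_smul]
    rfl
  let J := R ≪≫ₗ θ.symm
  have hJ (y' : Fin 3 → F) (v : V) :
      v ∈ LinearMap.range (J.toLinearMap ∘ₗ LinearMap.pi fun i => y' i • LinearMap.id) ↔
        ∃ x, θ v = Matrix.vecMulVec x (b.equivFun.symm y') := by
    refine exists_congr fun x => ?_
    rw [← hR, eq_comm, ← LinearEquiv.eq_symm_apply]
    rfl
  refine ⟨J, ?_, ?_, ?_⟩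
  · intro i
    have : LinearMap.single F (fun _ : Fin 3 => Fin n → F) i =
        LinearMap.pi fun j => (Pi.single i 1 : Fin 3 → F) j • LinearMap.id := by
      ext w j a
      by_cases h : j = i
      · subst h; simp
      · simp [h]
    ext v
    rw [this, hJ, hy]
    have : b.equivFun.symm (Pi.single i 1) = c i • y i.castSucc := by
      rw [← hb, Module.Basis.equivFun_symm_apply]; simp [Pi.single_apply]
    rw [this]
    constructor
    · rintro ⟨x, hx⟩
      refine ⟨(c i)⁻¹ • x, ?_⟩
      rw [hx, Matrix.vecMulVec_smul, Matrix.smul_vecMulVec, smul_smul, mul_inv_cancel₀ (hc i),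
        one_smul]
    · rintro ⟨x, hx⟩
      exact ⟨c i • x, by rw [hx, Matrix.vecMulVec_smul, Matrix.smul_vecMulVec]⟩
  · have : (LinearMap.pi fun _ : Fin 3 => (LinearMap.id : (Fin n → F) →ₗ[F] _)) =
        LinearMap.pi fun j => (1 : Fin 3 → F) j • LinearMap.id := by
      simp
    ext v
    rw [this, hJ, hy, Module.Basis.equivFun_symm_apply, Fin.sum_univ_three]
    simp only [Pi.one_apply, one_smul, hb, hsum]
  · intro y' hy'
    exact ⟨b.equivFun.symm y', by simpa [-Module.Basis.equivFun_symm_apply] using hy', hJ y'⟩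

end

/-! ### Slopes of pseudo-arc elements seen from an axis -/

section

variable {F K W V : Type*} [Field F] [Field K] [Algebra F K]
  [AddCommGroup W] [Module F W] [AddCommGroup V] [Module F V]

/-- The `i`-th axis of the coordinate system `J`. -/
def frameAxis (J : (Fin 3 → W) ≃ₗ[F] V) (i : Fin 3) : Submodule F V :=
  LinearMap.range (J.toLinearMap ∘ₗ LinearMap.single F (fun _ => W) i)

theorem apply_mem_frameAxis (J : (Fin 3 → W) ≃ₗ[F] V) (i : Fin 3) (f : Fin 3 → W) :
    J f ∈ frameAxis J i ↔ ∃ w, f = Pi.single i w := by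
  simp [frameAxis, eq_comm]

/-- In the coordinates of a frame inside `H`, the elements of `H` have slopes in a field if one
axis induces a Desarguesian spread. -/
theorem IsPseudoArc.exists_slopes [Nontrivial W] {n : ℕ} (hn : n ≠ 0) {H : Set (Submodule F V)}
    (hH : IsPseudoArc n H) (J : (Fin 3 → W) ≃ₗ[F] V) (hJ : ∀ i, frameAxis J i ∈ H)
    (hJ' : LinearMap.range (J.toLinearMap ∘ₗ LinearMap.pi fun _ => LinearMap.id) ∈ H)
    {i a b : Fin 3} (hia : i ≠ a) (hib : i ≠ b) (hab : a ≠ b)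
    (hD : IsDesarguesianSpread K 2 (inducedSpread H (frameAxis J i))) :
    ∃ α : W ≃ₗ[F] K,
      (∀ E ∈ H, E ≠ frameAxis J i → E ≠ frameAxis J b →
        ∃ k, ∀ f, J f ∈ E → f b = conjMul α k (f a)) ∧
      ∀ k, ∃ E ∈ H, E ≠ frameAxis J i ∧ ∀ f, J f ∈ E → f b = conjMul α k (f a) := by
  obtain ⟨w₀, hw₀⟩ := exists_ne (0 : W)
  have hcover (l : Fin 3) : l = i ∨ l = a ∨ l = b := by lia
  have haxis {l m : Fin 3} (hlm : l ≠ m) : frameAxis J l ≠ frameAxis J m := by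
    intro h
    have := (apply_mem_frameAxis J l (Pi.single l w₀)).2 ⟨w₀, rfl⟩
    rw [h, apply_mem_frameAxis] at this
    obtain ⟨w, hw⟩ := this
    apply hw₀
    have := congrFun hw l
    simpa [hlm] using this
  set Q := (frameAxis J i).mkQ
  let j (l : Fin 3) : W →ₗ[F] V ⧸ frameAxis J i :=
    Q ∘ₗ J.toLinearMap ∘ₗ LinearMap.single F (fun _ => W) l
  have hj (l : Fin 3) (w : W) : j l w = Q (J (Pi.single l w)) := rfl
  have hmk (f : Fin 3 → W) : Q (J f) = j a (f a) + j b (f b) := by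
    rw [hj, hj, ← map_add, ← map_add, ← sub_eq_zero, ← map_sub, ← map_sub]
    refine (Submodule.Quotient.mk_eq_zero _).2 ((apply_mem_frameAxis _ _ _).2 ⟨f i, ?_⟩)
    ext l
    rcases hcover l with rfl | rfl | rfl <;> simp [*, Ne.symm]
  have hinj (x y : W) (h : j a x + j b y = 0) : x = 0 ∧ y = 0 := by
    rw [hj, hj, ← map_add, ← map_add] at h
    obtain ⟨w, hw⟩ := (apply_mem_frameAxis _ _ _).1 ((Submodule.Quotient.mk_eq_zero _).1 h)
    have h1 := congrFun hw a
    have h2 := congrFun hw b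
    simp [*, Ne.symm] at h1 h2
    exact ⟨h1, h2⟩
  have hspread {E : Submodule F V} (hE : E ∈ H) (hne : E ≠ frameAxis J i) :
      E.map Q ∈ inducedSpread H (frameAxis J i) := ⟨E, ⟨hE, hne⟩, rfl⟩
  have hja (l : Fin 3) : (frameAxis J l).map Q = LinearMap.range (j l) := by
    exact (LinearMap.range_comp _ _).symm
  have hdiag : LinearMap.range (j a + j b) =
      (LinearMap.range (J.toLinearMap ∘ₗ LinearMap.pi fun _ => LinearMap.id)).map Q := by
    rw [← LinearMap.range_comp]
    congr 1
    ext w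
    exact (hmk fun _ => w).symm
  have hdiag_ne : LinearMap.range (J.toLinearMap ∘ₗ LinearMap.pi fun _ => LinearMap.id) ≠
      frameAxis J i := by
    intro h
    have : J (fun _ => w₀) ∈ frameAxis J i := by rw [← h]; exact ⟨w₀, rfl⟩
    obtain ⟨w, hw⟩ := (apply_mem_frameAxis _ _ _).1 this
    exact hw₀ (by simpa [hia.symm] using congrFun hw a)
  obtain ⟨α, hα⟩ := hD.exists_slopes (j a) (j b) hinj
    (hja a ▸ hspread (hJ a) (haxis hia.symm)) (hja b ▸ hspread (hJ b) (haxis hib.symm))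
    (hdiag ▸ hspread hJ' hdiag_ne)
  have hslope {E : Submodule F V} {k : K}
      (hE : E.map Q = LinearMap.range (j a + j b ∘ₗ conjMul α k)) (f : Fin 3 → W)
      (hf : J f ∈ E) : f b = conjMul α k (f a) := by
    obtain ⟨w, hw⟩ := hE ▸ Submodule.mem_map_of_mem (f := Q) hf
    change j a w + j b (conjMul α k w) = Q (J f) at hw
    rw [hmk, ← sub_eq_zero, add_sub_add_comm, ← map_sub, ← map_sub] at hw
    obtain ⟨h1, h2⟩ := hinj _ _ hw
    rw [sub_eq_zero] at h1 h2
    rw [← h1, h2]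
  refine ⟨α, fun E hE hEi hEb => ?_, fun k => ?_⟩
  · rcases (hα _).1 (hspread hE hEi) with h | ⟨k, hk⟩
    -- Infinite slope would put `E` inside the span of axes `i` and `b`.
    · refine absurd ?_ (hH.not_le_sup hn (hJ i) (hJ b) hE (haxis hib) hEi.symm hEb.symm)
      have h1 : E.map Q ≤ (frameAxis J b).map Q := by rw [h, hja]
      rw [Submodule.map_le_iff_le_comap, Submodule.comap_map_eq, Submodule.ker_mkQ] at h1
      rwa [sup_comm]
    · exact ⟨k, hslope hk⟩
  · obtain ⟨E, ⟨hE, hne⟩, hk⟩ := (hα _).2 (Or.inr ⟨k, rfl⟩)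
    exact ⟨E, hE, hne, hslope hk⟩

/-- Applying `α` in each coordinate turns `w` into the scalar `α w` times `s`, so the space is the
`K`-line of `s`. -/
theorem range_conjMul_mem_range_fieldReduction (J : (Fin 3 → W) ≃ₗ[F] V) (α : W ≃ₗ[F] K)
    (s : Fin 3 → K) (hs : s ≠ 0) :
    LinearMap.range (J.toLinearMap ∘ₗ LinearMap.pi fun i => conjMul α (s i)) ∈
      Set.range (fieldReduction (J.symm ≪≫ₗ LinearEquiv.piCongrRight fun _ => α)) := by
  rw [mem_range_fieldReduction]
  refine ⟨s, hs, fun u => ?_⟩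
  constructor
  · rintro ⟨w, rfl⟩
    refine ⟨α w, ?_⟩
    ext i
    simp [mul_comm]
  · rintro ⟨k, hk⟩
    refine ⟨α.symm k, J.symm.injective ?_⟩
    ext i : 1
    apply α.injective
    have := congrFun hk i
    simp at this
    simp [this, mul_comm]

end

/-! ### The dichotomy on the intersection of the slope fields -/

theorem mainTheorem5 {F K V : Type*} [Field F] [Finite F] [Field K] [Algebra F K]
    [AddCommGroup V] [Module F V] (n h : ℕ) (hn : n.Prime) (hh : 1 < h)
    (hq : Nat.card F = 2 ^ h) (hK : Module.finrank F K = n)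
    (hV : Module.finrank F V = 3 * n) (H : Set (Submodule F V))
    (hH : IsPseudoHyperoval n H) (hP1 : PropertyP1 K n H) :
    IsElementary K H := by
  obtain ⟨E, hE, hEH, hD0, hD1, hD2, B, hB, hEB, hcard⟩ := hP1
  have hn0 := hn.ne_zero
  have : NeZero n := ⟨hn0⟩
  have hA := hH.isPseudoArc
  obtain ⟨J, hJ, hJ3, hJB⟩ := hB.exists_frame hn0 hA hE hEH hEB
  change ∀ i : Fin 3, E i.castSucc = frameAxis J i at hJ
  have hJH (i : Fin 3) : frameAxis J i ∈ H := hJ i ▸ hEH _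
  have hJ3H := hJ3 ▸ hEH 3
  have hE0 : E 0 = frameAxis J 0 := hJ 0
  have hE1 : E 1 = frameAxis J 1 := hJ 1
  have hE2 : E 2 = frameAxis J 2 := hJ 2
  have haxis : Function.Injective (frameAxis J) := by
    intro l m hlm
    rw [← hJ, ← hJ] at hlm
    exact Fin.castSucc_injective 3 (hE hlm)
  rw [hE0] at hD0
  rw [hE1] at hD1
  rw [hE2] at hD2
  obtain ⟨α₀, h₀, -⟩ := hA.exists_slopes hn0 J hJH hJ3H (a := 1) (b := 2)
    (by decide) (by decide) (by decide) hD0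
  obtain ⟨α₁, h₁, h₁'⟩ := hA.exists_slopes hn0 J hJH hJ3H (a := 0) (b := 2)
    (by decide) (by decide) (by decide) hD1
  obtain ⟨α₂, h₂, -⟩ := hA.exists_slopes hn0 J hJH hJ3H (a := 0) (b := 1)
    (by decide) (by decide) (by decide) hD2
  -- `E'` lies in the graph, whose dimension is at most `n`; hence they are equal.
  have hform {E' : Submodule F V} (hE' : E' ∈ H) (A C : Module.End F (Fin n → F))
      (hA1 : ∀ f, J f ∈ E' → f 1 = A (f 0)) (hC : ∀ f, J f ∈ E' → f 2 = C (f 0)) :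
      E' = LinearMap.range (J.toLinearMap ∘ₗ LinearMap.pi ![LinearMap.id, A, C]) := by
    refine Submodule.eq_of_le_of_finrank_le ?_ ?_
    · intro v hv
      obtain ⟨f, rfl⟩ := J.surjective v
      refine ⟨f 0, congrArg J ?_⟩
      ext i : 1
      fin_cases i
      · rfl
      · exact (hA1 f hv).symm
      · exact (hC f hv).symm
    · rw [hA.finrank_eq E' hE']
      exact (LinearMap.finrank_range_le _).trans (by simp)
  have hmul {E' : Submodule F V} {A C G : Module.End F (Fin n → F)}
      (hE' : E' = LinearMap.range (J.toLinearMap ∘ₗ LinearMap.pi ![LinearMap.id, A, C]))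
      (hG : ∀ f, J f ∈ E' → f 2 = G (f 1)) : C = G * A := by
    refine LinearMap.ext fun w => ?_
    exact hG (fun i => ![LinearMap.id, A, C] i w) (hE' ▸ ⟨w, rfl⟩)
  have := Subalgebra.isSimpleOrder_of_finrank_prime F K (hK ▸ hn)
  -- This subalgebra of `K` is `K₀ ∩ K₂`, pulled back along `conjMul α₂`.
  rcases eq_bot_or_eq_top ((conjMul α₀).range.comap (conjMul α₂)) with hbot | htop
  · refine absurd ?_ hcard
    obtain ⟨w₀, hw₀⟩ := exists_ne (0 : Fin n → F)
    have hex (c : Fˣ) : ∃ E' ∈ H ∩ B, (∀ i, E' ≠ frameAxis J i) ∧ ∃ b : F, E' =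
        LinearMap.range (J.toLinearMap ∘ₗ LinearMap.pi fun i => ![1, b, (c : F)] i •
          (LinearMap.id : Module.End F (Fin n → F))) := by
      obtain ⟨E', hE', hne₁, hk₁⟩ := h₁' (algebraMap F K c)
      rw [AlgHom.commutes] at hk₁
      have hne₀ : E' ≠ frameAxis J 0 := by
        rintro rfl
        have := hk₁ _ ((apply_mem_frameAxis J 0 _).2 ⟨w₀, rfl⟩)
        simp [Module.algebraMap_end_apply] at this
        exact smul_ne_zero c.ne_zero hw₀ this.symm
      have hne₂ : E' ≠ frameAxis J 2 := by
        rintro rfl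
        have := hk₁ _ ((apply_mem_frameAxis J 2 _).2 ⟨w₀, rfl⟩)
        simp at this
        exact hw₀ this
      obtain ⟨k₀, hk₀⟩ := h₀ E' hE' hne₀ hne₂
      obtain ⟨k₂, hk₂⟩ := h₂ E' hE' hne₂ hne₁
      have hEq := hform hE' _ _ hk₂ hk₁
      have hm := hmul hEq hk₀
      have hk₀0 : k₀ ≠ 0 := by
        rintro rfl
        have := LinearMap.congr_fun hm w₀
        simp [Module.algebraMap_end_apply] at this
        exact hw₀ this
      have hmem : k₂ ∈ (conjMul α₀).range.comap (conjMul α₂) := by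
        -- From `c = G A` with `G = conjMul α₀ k₀`, one gets `A = G⁻¹ c`.
        refine ⟨k₀⁻¹ * algebraMap F K c, ?_⟩
        change conjMul α₀ _ = conjMul α₂ k₂
        rw [map_mul, AlgHom.commutes, hm, ← mul_assoc, ← map_mul, inv_mul_cancel₀ hk₀0, map_one,
          one_mul]
      rw [hbot, Algebra.mem_bot] at hmem
      obtain ⟨b, rfl⟩ := hmem
      rw [AlgHom.commutes] at hEq
      have hEq' : E' =
          LinearMap.range (J.toLinearMap ∘ₗ LinearMap.pi fun i => ![1, b, (c : F)] i •
            (LinearMap.id : Module.End F (Fin n → F))) := by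
        rw [hEq]
        congr 3
        ext1 i
        fin_cases i
        · exact (one_smul F _).symm
        · rfl
        · rfl
      refine ⟨E', ⟨hE', ?_⟩, ?_, b, hEq'⟩
      · rw [hEq']
        exact hJB _ fun h => one_ne_zero (congrFun h 0)
      · intro i
        fin_cases i <;> assumption
    choose g hgHB hgne hg using hex
    have hginj : Function.Injective g := by
      intro c d hcd
      obtain ⟨b, hb⟩ := hg c
      obtain ⟨b', hb'⟩ := hg d
      have : J (fun i => ![1, b, (c : F)] i • w₀) ∈ g d := by
        rw [← hcd, hb]
        exact ⟨w₀, rfl⟩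
      rw [hb'] at this
      obtain ⟨w, hw⟩ := this
      have hw' := J.injective hw
      have h0 : w = w₀ := by simpa using congrFun hw' 0
      have h2 : (d : F) • w = (c : F) • w₀ := congrFun hw' 2
      rw [h0] at h2
      exact Units.ext (smul_left_injective F hw₀ h2).symm
    have hdisj : Disjoint (Set.range g) (Set.range (frameAxis J)) := by
      rw [Set.disjoint_left]
      rintro _ ⟨c, rfl⟩ ⟨i, hi⟩
      exact hgne c i hi.symm
    have hfin : H.Finite := Set.finite_of_ncard_ne_zero (by rw [hH.ncard_eq]; lia)
    have hsub : Set.range g ∪ Set.range (frameAxis J) ⊆ H ∩ B := by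
      rintro _ (⟨c, rfl⟩ | ⟨i, rfl⟩)
      · exact hgHB c
      · exact ⟨hJH i, hJ i ▸ hEB _⟩
    -- The count is `(q - 1) + 3 = q + 2`.
    have hle := Set.ncard_le_ncard hsub (hfin.inter_of_left B)
    rw [Set.ncard_union_eq hdisj (Set.finite_range _) (Set.finite_range _), ← Set.image_univ,
      ← Set.image_univ, Set.ncard_image_of_injective _ hginj, Set.ncard_image_of_injective _ haxis,
      Set.ncard_univ, Set.ncard_univ, Nat.card_units, Nat.card_fin] at hle
    have : 0 < Nat.card F := Nat.card_pos
    lia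
  · refine hA.isElementary hn0 (J.symm ≪≫ₗ LinearEquiv.piCongrRight fun _ => α₀) ?_
    intro E' hE'
    -- Axes have no slope from some vertices; they are the spread elements of the unit vectors.
    by_cases haxE : ∃ i, E' = frameAxis J i
    · obtain ⟨i, rfl⟩ := haxE
      convert range_conjMul_mem_range_fieldReduction J α₀ (Pi.single i 1) (by simp)
      rw [frameAxis]
      congr 2
      ext w j a
      by_cases hji : j = i
      · subst hji; simp
      · simp [hji]
    · push Not at haxE
      obtain ⟨k₀, hk₀⟩ := h₀ E' hE' (haxE 0) (haxE 2)
      obtain ⟨k₁, hk₁⟩ := h₁ E' hE' (haxE 1) (haxE 2)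
      obtain ⟨k₂, hk₂⟩ := h₂ E' hE' (haxE 2) (haxE 1)
      have hEq := hform hE' _ _ hk₂ hk₁
      have hm := hmul hEq hk₀
      obtain ⟨s, hs⟩ : k₂ ∈ (conjMul α₀).range.comap (conjMul α₂) := htop ▸ Algebra.mem_top
      change conjMul α₀ s = conjMul α₂ k₂ at hs
      rw [hm, ← hs, ← map_mul] at hEq
      have hpt : ![LinearMap.id, conjMul α₀ s, conjMul α₀ (k₀ * s)] =
          fun i => conjMul α₀ (![1, s, k₀ * s] i) := by
        refine funext fun i => ?_
        fin_cases i
        · exact (map_one (conjMul α₀)).symm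
        · rfl
        · rfl
      rw [hEq, hpt]
      exact range_conjMul_mem_range_fieldReduction J α₀ _ fun h => one_ne_zero (congrFun h 0)
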